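/- Let $n\ge 1$, $0<s<1$, let $\Omega\subset\mathbb R^n$ be a bounded smooth domain (a nonempty, bounded, connected open set with $C^\infty$ boundary), and let $1\le q<2^*_s$, $q\neq 2$, where $2^*_s=\frac{2n}{n-2s}$ if $2s<n$ and $2^*_s=\infty$ otherwise. For a bounded open set $U\subset\mathbb R^n$ write $$H^s(U)=\Big\{u\in L^2(U):\ \tfrac{u(x)-u(y)}{|x-y|^{n/2+s}}\in L^2(U\times U)\Big\},\qquad [u]_{s;U}^2=\iint_{U\times U}\frac{(u(x)-u(y))^2}{|x-y|^{n+2s}}\,dx\,dy,$$ $$\|u\|_{s;U}^2=[u]_{s;U}^2+\|u\|_{L^2(U)}^2,\qquad S(U)=\inf_{0\ne u\in H^s(U)}\frac{\|u\|_{s;U}^2}{\|u\|_{L^q(U)}^2},$$ where all functions are real-valued, and call a nonzero $u\in H^s(U)$ an extremal for $S(U)$ if it attains this infimum. For $\varepsilon>0$ let $\Omega_\varepsilon=\varepsilon\Omega=\{\varepsilon x:x\in\Omega\}$. Then $$\lim_{\varepsilon\downarrow0}\frac{S(\Omega_\varepsilon)}{\varepsilon^{n(1-2/q)}}=|\Omega|^{1-\frac2q}.$$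 Moreover, for all sufficiently small $\varepsilon>0$ let $u_\varepsilon\in H^s(\Omega_\varepsilon)$ be an extremal for $S(\Omega_\varepsilon)$ such that the rescaled function $\bar u_\varepsilon(x)=u_\varepsilon(\varepsilon x)$ satisfies $\|\bar u_\varepsilon\|_{L^q(\Omega)}=1$. Then $\bar u_\varepsilon\in H^s(\Omega)$ for all sufficiently small $\varepsilon>0$, and, up to the choice of sign, $\bar u_\varepsilon$ converges strongly to the constant $|\Omega|^{-1/q}$: there are signs $\sigma_\varepsilon\in\{1,-1\}$ such that $$\|\sigma_\varepsilon\bar u_\varepsilon-|\Omega|^{-1/q}\|_{s;\Omega}\to0\qquad\text{as }\varepsilon\downarrow0.$$ In particular, if $u_\varepsilon\ge0$ a.e. in $\Omega_\varepsilon$ for all sufficiently small $\varepsilon>0$, then $\|\bar u_\varepsilon-|\Omega|^{-1/q}\|_{s;\Omega}\to0$ as $\varepsilon\downarrow0$. -/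

import Mathlib

open MeasureTheory Filter Topology
open scoped Pointwise ContDiff ENNReal

namespace FracSobolev

/-- The Euclidean space `ℝⁿ`. -/
abbrev Rn (n : ℕ) : Type := EuclideanSpace ℝ (Fin n)

/-- A bounded smooth domain of `ℝⁿ`: a bounded (nonempty) connected open set which near each of
its boundary points is the region `{ρ < 0}` for a smooth function `ρ` whose differential
does not vanish at that boundary point. -/
structure IsBoundedSmoothDomain {n : ℕ} (Ω : Set (Rn n)) : Prop where
  isOpen : IsOpen Ω
  isConnected : IsConnected Ω
  isBounded : Bornology.IsBounded Ω
  smooth_boundary : ∀ x ∈ frontier Ω, ∃ U ∈ 𝓝 x, ∃ ρ : Rn n → ℝ,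
    ContDiff ℝ ∞ ρ ∧ fderiv ℝ ρ x ≠ 0 ∧ ∀ y ∈ U, (y ∈ Ω ↔ ρ y < 0)

/-- The fractional critical exponent: `2n / (n - 2s)` if `2s < n`, and `∞` otherwise. -/
noncomputable def critExp (n : ℕ) (s : ℝ) : ℝ≥0∞ :=
  if 2 * s < (n : ℝ) then ENNReal.ofReal (2 * (n : ℝ) / ((n : ℝ) - 2 * s)) else ⊤

/-- Lebesgue measure on `Ω × Ω`. -/
noncomputable def prodMeasure {n : ℕ} (Ω : Set (Rn n)) : Measure (Rn n × Rn n) :=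
  (volume.restrict Ω).prod (volume.restrict Ω)

/-- Membership in `H^s(Ω)`: `u ∈ L²(Ω)` and
`(u x - u y) / |x - y| ^ (n / 2 + s) ∈ L²(Ω × Ω)`. -/
def MemHs {n : ℕ} (s : ℝ) (Ω : Set (Rn n)) (u : Rn n → ℝ) : Prop :=
  MemLp u 2 (volume.restrict Ω) ∧
  MemLp (fun p : Rn n × Rn n => (u p.1 - u p.2) / ‖p.1 - p.2‖ ^ ((n : ℝ) / 2 + s)) 2
    (prodMeasure Ω)

/-- The norm of `L^r(Ω)`, for a finite exponent `r`. -/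
noncomputable def normL {n : ℕ} (r : ℝ) (Ω : Set (Rn n)) (u : Rn n → ℝ) : ℝ :=
  (eLpNorm u (ENNReal.ofReal r) (volume.restrict Ω)).toReal

/-- The Gagliardo seminorm `[u]_{s;Ω}`. -/
noncomputable def gagliardo {n : ℕ} (s : ℝ) (Ω : Set (Rn n)) (u : Rn n → ℝ) : ℝ :=
  Real.sqrt (∫ p : Rn n × Rn n,
    (u p.1 - u p.2) ^ 2 / ‖p.1 - p.2‖ ^ ((n : ℝ) + 2 * s) ∂(prodMeasure Ω))

/-- The norm of `H^s(Ω)`. -/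
noncomputable def normHs {n : ℕ} (s : ℝ) (Ω : Set (Rn n)) (u : Rn n → ℝ) : ℝ :=
  Real.sqrt (gagliardo s Ω u ^ 2 + normL 2 Ω u ^ 2)

/-- `u` is a nonzero element of `H^s(Ω)`. -/
def MemHsNonzero {n : ℕ} (s : ℝ) (Ω : Set (Rn n)) (u : Rn n → ℝ) : Prop :=
  MemHs s Ω u ∧ ¬ (u =ᵐ[volume.restrict Ω] 0)

/-- The quotient `‖u‖_{s;Ω}² / ‖u‖_{q;Ω}²`. -/
noncomputable def quotient {n : ℕ} (s q : ℝ) (Ω : Set (Rn n)) (u : Rn n → ℝ) : ℝ :=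
  normHs s Ω u ^ 2 / normL q Ω u ^ 2

/-- The Sobolev constant `S(Ω) = S_{s,q}(Ω)`, the infimum of the quotient over the nonzero
elements of `H^s(Ω)`. -/
noncomputable def sobolevConst {n : ℕ} (s q : ℝ) (Ω : Set (Rn n)) : ℝ :=
  sInf (quotient s q Ω '' {u | MemHsNonzero s Ω u})

/-- `u` is an extremal for `S(Ω)`: a nonzero element of `H^s(Ω)` attaining the infimum. -/
def IsExtremal {n : ℕ} (s q : ℝ) (Ω : Set (Rn n)) (u : Rn n → ℝ) : Prop :=
  MemHsNonzero s Ω u ∧ quotient s q Ω u = sobolevConst s q Ω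

/-- The rescaled function `x ↦ u (ε x)`. -/
def rescale {n : ℕ} (ε : ℝ) (u : Rn n → ℝ) : Rn n → ℝ := fun x => u (ε • x)

end FracSobolev

/-! Put `v x = u (ε x)`. The quotient of `u` on `ε Ω` is `ε^(n(1-2/q))` times `E(v) / ‖v‖_q²`, with
`E(v) = ε^(-2s) [v]² + ‖v‖₂²` on the fixed domain. As `ε → 0` the seminorm is penalised ever more
heavily and only constants survive. The constant `1` gives the upper bound `|Ω|^(1-2/q)` for every
`ε`.

For the lower bound, the Poincaré–Sobolev inequality `‖v - m‖_r ≤ C [v]` (`m` the mean, `r = 2, q`)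
gives `‖v‖_q ≤ |Ω|^(1/q-1/2) ‖v‖₂ + C' [v]`, and `[v] ≤ ε^s √E(v)`. For a normalised extremal, `E(v)
≤ |Ω|^(1-2/q)`, so `[v] = O(ε^s)`; up to sign, the distance from `v` to the constant is `O([v])`. No
compactness of the embedding is needed.

Poincaré in `L²` holds because the kernel is bounded below on a bounded set. The embedding into
`L^q` is a bootstrap (`EmbedsIn.improve`): comparing `w x` with the values of `w` on a ball inside
`Ω` of size about `r` near `x` gives `|w x| ≲ r^s g x + r^(-n/p) ‖w‖_p`, where `g²` is the inner
Gagliardo integral. Optimising in `r` and integrating passes from `L^p` to `L^(2+2sp/n)`; finitely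
many rounds reach any subcritical `q`. Smoothness of the boundary serves only to supply those balls.
-/

namespace FracSobolev

/-! ### Dilations and the scaling of the norms -/

theorem measurableEmbedding_smul {n : ℕ} {ε : ℝ} (hε : 0 < ε) :
    MeasurableEmbedding (fun x : Rn n => ε • x) :=
  (Homeomorph.smulOfNeZero ε hε.ne').toMeasurableEquiv.measurableEmbedding

theorem measurableEmbedding_smul_prod {n : ℕ} {ε : ℝ} (hε : 0 < ε) :
    MeasurableEmbedding
      (Prod.map (fun x : Rn n => ε • x) (fun x : Rn n => ε • x)) :=
  (measurableEmbedding_smul hε).prodMap (measurableEmbedding_smul hε)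

/-- As an identity of measures, it transports norms, integrals and a.e. statements alike. No
measurability of `Ω` is needed, since a dilation is a measurable embedding. -/
theorem restrict_smul_set {n : ℕ} {ε : ℝ} (hε : 0 < ε) (Ω : Set (Rn n)) :
    (volume : Measure (Rn n)).restrict (ε • Ω) =
      ENNReal.ofReal (ε ^ n) • (volume.restrict Ω).map (fun x : Rn n => ε • x) := by
  have h1 : (volume : Measure (Rn n)).map (fun x : Rn n => ε • x) =
      ENNReal.ofReal (ε ^ n)⁻¹ • volume := by
    rw [Measure.map_addHaar_smul _ hε.ne', finrank_euclideanSpace_fin, abs_of_pos (by positivity)]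
  have h2 : (fun x : Rn n => ε • x) ⁻¹' (ε • Ω) = Ω :=
    Set.preimage_image_eq _ (measurableEmbedding_smul hε).injective
  have h3 := (measurableEmbedding_smul hε).restrict_map (volume : Measure (Rn n)) (ε • Ω)
  rw [h1, h2, Measure.restrict_smul] at h3
  rw [← h3, smul_smul, ← ENNReal.ofReal_mul (by positivity), mul_inv_cancel₀ (by positivity),
    ENNReal.ofReal_one, one_smul]

theorem prodMeasure_smul_set {n : ℕ} {ε : ℝ} (hε : 0 < ε) (Ω : Set (Rn n)) :
    prodMeasure (ε • Ω) = ENNReal.ofReal (ε ^ (2 * n)) •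
      (prodMeasure Ω).map (Prod.map (fun x : Rn n => ε • x) (fun x : Rn n => ε • x)) := by
  have hm : Measurable (fun x : Rn n => ε • x) := measurable_const_smul ε
  unfold prodMeasure
  rw [restrict_smul_set hε, Measure.prod_smul_left, Measure.prod_smul_right,
    Measure.map_prod_map _ _ hm hm, smul_smul, ← ENNReal.ofReal_mul (by positivity)]
  congr 2
  ring

theorem ae_restrict_smul_set {n : ℕ} {ε : ℝ} (hε : 0 < ε) (Ω : Set (Rn n)) (p : Rn n → Prop) :
    (∀ᵐ x ∂(volume.restrict (ε • Ω)), p x) ↔ ∀ᵐ x ∂(volume.restrict Ω), p (ε • x) := by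
  rw [restrict_smul_set hε, Measure.ae_ennreal_smul_measure_iff (by positivity),
    (measurableEmbedding_smul hε).ae_map_iff]

theorem normL_smul_set {n : ℕ} {ε r : ℝ} (hε : 0 < ε) (hr : 0 < r) (Ω : Set (Rn n))
    (u : Rn n → ℝ) :
    normL r (ε • Ω) u = ε ^ ((n : ℝ) / r) * normL r Ω (rescale ε u) := by
  unfold normL
  rw [restrict_smul_set hε, eLpNorm_smul_measure_of_ne_top ENNReal.ofReal_ne_top,
    (measurableEmbedding_smul hε).eLpNorm_map_measure, smul_eq_mul, ENNReal.toReal_mul]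
  congr 1
  rw [← ENNReal.toReal_rpow, ENNReal.toReal_ofReal (by positivity), one_div, ENNReal.toReal_inv,
    ENNReal.toReal_ofReal hr.le, ← Real.rpow_natCast, ← Real.rpow_mul hε.le, div_eq_mul_inv]

theorem gagliardo_sq {n : ℕ} (s : ℝ) (Ω : Set (Rn n)) (u : Rn n → ℝ) :
    gagliardo s Ω u ^ 2 = ∫ p : Rn n × Rn n,
      (u p.1 - u p.2) ^ 2 / ‖p.1 - p.2‖ ^ ((n : ℝ) + 2 * s) ∂(prodMeasure Ω) :=
  Real.sq_sqrt (integral_nonneg fun _ => by positivity)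

theorem gagliardo_nonneg {n : ℕ} (s : ℝ) (Ω : Set (Rn n)) (u : Rn n → ℝ) :
    0 ≤ gagliardo s Ω u := Real.sqrt_nonneg _

theorem normL_nonneg {n : ℕ} (r : ℝ) (Ω : Set (Rn n)) (u : Rn n → ℝ) :
    0 ≤ normL r Ω u := ENNReal.toReal_nonneg

theorem normHs_nonneg {n : ℕ} (s : ℝ) (Ω : Set (Rn n)) (u : Rn n → ℝ) :
    0 ≤ normHs s Ω u := Real.sqrt_nonneg _

theorem normHs_sq {n : ℕ} (s : ℝ) (Ω : Set (Rn n)) (u : Rn n → ℝ) :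
    normHs s Ω u ^ 2 = gagliardo s Ω u ^ 2 + normL 2 Ω u ^ 2 :=
  Real.sq_sqrt (by positivity)

theorem norm_smul_sub_rpow {n : ℕ} {ε : ℝ} (hε : 0 < ε) (x y : Rn n) (a : ℝ) :
    ‖ε • x - ε • y‖ ^ a = ε ^ a * ‖x - y‖ ^ a := by
  rw [← smul_sub, norm_smul, Real.norm_of_nonneg hε.le, Real.mul_rpow hε.le (norm_nonneg _)]

/-- The exponent is `2n` from the product measure minus `n + 2s` from the kernel. -/
theorem gagliardo_sq_smul_set {n : ℕ} {ε : ℝ} (hε : 0 < ε) (s : ℝ) (Ω : Set (Rn n))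
    (u : Rn n → ℝ) :
    gagliardo s (ε • Ω) u ^ 2 = ε ^ ((n : ℝ) - 2 * s) * gagliardo s Ω (rescale ε u) ^ 2 := by
  rw [gagliardo_sq, gagliardo_sq, prodMeasure_smul_set hε, integral_smul_measure,
    (measurableEmbedding_smul_prod hε).integral_map, ENNReal.toReal_ofReal (by positivity),
    smul_eq_mul]
  have hpt : ∀ p : Rn n × Rn n,
      (u (Prod.map (fun x : Rn n => ε • x) (fun x : Rn n => ε • x) p).1 -
        u (Prod.map (fun x : Rn n => ε • x) (fun x : Rn n => ε • x) p).2) ^ 2 /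
        ‖(Prod.map (fun x : Rn n => ε • x) (fun x : Rn n => ε • x) p).1 -
          (Prod.map (fun x : Rn n => ε • x) (fun x : Rn n => ε • x) p).2‖ ^ ((n : ℝ) + 2 * s) =
      (ε ^ ((n : ℝ) + 2 * s))⁻¹ * ((rescale ε u p.1 - rescale ε u p.2) ^ 2 /
        ‖p.1 - p.2‖ ^ ((n : ℝ) + 2 * s)) := by
    intro p
    simp only [Prod.map_fst, Prod.map_snd, rescale, norm_smul_sub_rpow hε]
    rw [div_mul_eq_div_div, div_eq_mul_inv _ (ε ^ ((n : ℝ) + 2 * s))]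
    ring
  simp_rw [hpt]
  rw [integral_const_mul, ← mul_assoc, ← Real.rpow_natCast, ← Real.rpow_neg hε.le,
    ← Real.rpow_add hε]
  congr 2
  push_cast
  ring

theorem memLp_of_memLp_smul_measure {α : Type*} {_ : MeasurableSpace α} {μ : Measure α} {c : ℝ}
    (hc : 0 < c) {f : α → ℝ} {p : ℝ≥0∞} (hf : MemLp f p (ENNReal.ofReal c • μ)) : MemLp f p μ := by
  refine hf.of_measure_le_smul (c := ENNReal.ofReal c⁻¹) ENNReal.ofReal_ne_top ?_
  rw [smul_smul, ← ENNReal.ofReal_mul (by positivity), inv_mul_cancel₀ hc.ne', ENNReal.ofReal_one,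
    one_smul]

theorem MemHs.rescale {n : ℕ} {ε s : ℝ} (hε : 0 < ε) {Ω : Set (Rn n)} {u : Rn n → ℝ}
    (hu : MemHs s (ε • Ω) u) : MemHs s Ω (rescale ε u) := by
  obtain ⟨h1, h2⟩ := hu
  constructor
  · rw [restrict_smul_set hε] at h1
    exact (measurableEmbedding_smul hε).memLp_map_measure_iff.1
      (memLp_of_memLp_smul_measure (by positivity) h1)
  · rw [prodMeasure_smul_set hε] at h2
    refine (((measurableEmbedding_smul_prod hε).memLp_map_measure_iff.1
      (memLp_of_memLp_smul_measure (by positivity) h2)).const_mul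
        (ε ^ ((n : ℝ) / 2 + s))).ae_eq (Eventually.of_forall fun p => ?_)
    simp only [Function.comp_apply, Prod.map_fst, Prod.map_snd, FracSobolev.rescale,
      norm_smul_sub_rpow hε]
    rw [div_mul_eq_div_div_swap, mul_div_cancel₀ _ (by positivity)]

/-! ### The fractional Poincaré inequality -/

theorem gagliardo_integrable {n : ℕ} {s : ℝ} {Ω : Set (Rn n)} {u : Rn n → ℝ}
    (hu : MemHs s Ω u) :
    Integrable (fun p : Rn n × Rn n =>
      (u p.1 - u p.2) ^ 2 / ‖p.1 - p.2‖ ^ ((n : ℝ) + 2 * s)) (prodMeasure Ω) := by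
  refine hu.2.integrable_sq.congr (Eventually.of_forall fun p => ?_)
  simp only [div_pow]
  rw [← Real.rpow_natCast (‖p.1 - p.2‖ ^ _), ← Real.rpow_mul (norm_nonneg _)]
  congr 2
  push_cast
  ring

theorem normL_two_sq {n : ℕ} {Ω : Set (Rn n)} {u : Rn n → ℝ}
    (hu : MemLp u 2 (volume.restrict Ω)) : normL 2 Ω u ^ 2 = ∫ x in Ω, u x ^ 2 := by
  have h := hu.eLpNorm_eq_integral_rpow_norm (by norm_num) (by norm_num)
  unfold normL
  rw [ENNReal.ofReal_ofNat, h, ENNReal.toReal_ofReal (by positivity)]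
  simp only [ENNReal.toReal_ofNat, Real.rpow_ofNat, Real.norm_eq_abs, sq_abs]
  rw [← Real.rpow_natCast, ← Real.rpow_mul (integral_nonneg fun _ => by positivity)]
  norm_num

theorem MemHs.sub_const {n : ℕ} {s : ℝ} {Ω : Set (Rn n)} [IsFiniteMeasure (volume.restrict Ω)]
    {u : Rn n → ℝ} (hu : MemHs s Ω u) (c : ℝ) : MemHs s Ω (fun x => u x - c) :=
  ⟨hu.1.sub (memLp_const c), by simpa only [sub_sub_sub_cancel_right] using hu.2⟩

theorem gagliardo_sub_const {n : ℕ} (s : ℝ) (Ω : Set (Rn n)) (u : Rn n → ℝ) (c : ℝ) :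
    gagliardo s Ω (fun x => u x - c) = gagliardo s Ω u := by
  simp only [gagliardo, sub_sub_sub_cancel_right]

/-- The variance identity `∬ (u x - u y)² = 2 |Ω| ∫ (u - m)²`, where `m` is the mean of `u`. -/
theorem integral_sub_sq_prodMeasure {n : ℕ} {Ω : Set (Rn n)}
    [IsFiniteMeasure (volume.restrict Ω)] (hΩ : (volume Ω).toReal ≠ 0)
    {u : Rn n → ℝ} (hu : MemLp u 2 (volume.restrict Ω)) :
    Integrable (fun p : Rn n × Rn n => (u p.1 - u p.2) ^ 2) (prodMeasure Ω) ∧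
    ∫ p : Rn n × Rn n, (u p.1 - u p.2) ^ 2 ∂(prodMeasure Ω) =
      2 * (volume Ω).toReal * ∫ x in Ω, (u x - (∫ y in Ω, u y) / (volume Ω).toReal) ^ 2 := by
  have hu1 : Integrable u (volume.restrict Ω) := hu.integrable (by norm_num)
  have hu2 : Integrable (fun x => u x ^ 2) (volume.restrict Ω) := hu.integrable_sq
  have i1 : Integrable (fun p : Rn n × Rn n => u p.1 ^ 2) (prodMeasure Ω) := hu2.comp_fst _
  have i2 : Integrable (fun p : Rn n × Rn n => u p.2 ^ 2) (prodMeasure Ω) := hu2.comp_snd _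
  have i3 : Integrable (fun p : Rn n × Rn n => 2 * (u p.1 * u p.2)) (prodMeasure Ω) :=
    (hu1.mul_prod hu1).const_mul 2
  have i12 : Integrable (fun p : Rn n × Rn n => u p.1 ^ 2 + u p.2 ^ 2) (prodMeasure Ω) := i1.add i2
  have e : (fun p : Rn n × Rn n => (u p.1 - u p.2) ^ 2) =
      fun p => u p.1 ^ 2 + u p.2 ^ 2 - 2 * (u p.1 * u p.2) := by
    funext p; ring
  refine ⟨by rw [e]; exact i12.sub i3, ?_⟩
  rw [e, integral_sub i12 i3, integral_add i1 i2, integral_const_mul]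
  set V := (volume Ω).toReal with hV
  have hVr : (volume.restrict Ω).real Set.univ = V := by simp [Measure.real, hV]
  set m := (∫ y in Ω, u y) / V with hm
  have hmV : (∫ y in Ω, u y) = m * V := by rw [hm]; field_simp
  have e1 : ∫ p : Rn n × Rn n, u p.1 ^ 2 ∂(prodMeasure Ω) = V * ∫ x in Ω, u x ^ 2 := by
    rw [prodMeasure, integral_fun_fst (fun x => u x ^ 2), hVr, smul_eq_mul]
  have e2 : ∫ p : Rn n × Rn n, u p.2 ^ 2 ∂(prodMeasure Ω) = V * ∫ x in Ω, u x ^ 2 := by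
    rw [prodMeasure, integral_fun_snd (fun x => u x ^ 2), hVr, smul_eq_mul]
  have e3 : ∫ p : Rn n × Rn n, u p.1 * u p.2 ∂(prodMeasure Ω) = (m * V) * (m * V) := by
    rw [prodMeasure, integral_prod_mul, hmV]
  have e4 : ∫ x in Ω, (u x - m) ^ 2 = (∫ x in Ω, u x ^ 2) - m ^ 2 * V := by
    have : (fun x => (u x - m) ^ 2) = fun x => u x ^ 2 - 2 * m * u x + m ^ 2 := by
      funext x; ring
    have j : Integrable (fun x => u x ^ 2 - 2 * m * u x) (volume.restrict Ω) :=
      hu2.sub (hu1.const_mul _)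
    rw [this, integral_add j (integrable_const _),
      integral_sub hu2 (hu1.const_mul _), integral_const_mul, hmV, integral_const, hVr, smul_eq_mul]
    ring
  rw [e1, e2, e3, e4]
  ring

/-- The fractional Poincaré inequality on a bounded set. -/
theorem poincare {n : ℕ} {s : ℝ} (hs : 0 < s) {Ω : Set (Rn n)} (hm : MeasurableSet Ω)
    (hb : Bornology.IsBounded Ω) [IsFiniteMeasure (volume.restrict Ω)]
    (hΩ : 0 < (volume Ω).toReal) :
    ∃ C : ℝ, 0 < C ∧ ∀ u, MemHs s Ω u →
      normL 2 Ω (fun x => u x - (∫ y in Ω, u y) / (volume Ω).toReal) ≤ C * gagliardo s Ω u := by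
  obtain ⟨D, hD⟩ := Metric.isBounded_iff.1 hb
  -- The diameter bound `D` need not be positive.
  set D' := max D 1
  have hD' : 0 < D' := lt_max_of_lt_right one_pos
  set V := (volume Ω).toReal
  refine ⟨√(D' ^ ((n : ℝ) + 2 * s) / (2 * V)), by positivity, fun u hu => ?_⟩
  obtain ⟨hi, he⟩ := integral_sub_sq_prodMeasure hΩ.ne' hu.1
  -- The kernel is at least `D'^(-(n+2s))` off the diagonal; on it both integrands vanish.
  have key : ∫ p : Rn n × Rn n, (u p.1 - u p.2) ^ 2 ∂(prodMeasure Ω) ≤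
      D' ^ ((n : ℝ) + 2 * s) * gagliardo s Ω u ^ 2 := by
    rw [gagliardo_sq, ← integral_const_mul]
    refine integral_mono_ae hi ((gagliardo_integrable hu).const_mul _) ?_
    have : prodMeasure Ω = (volume.prod volume).restrict (Ω ×ˢ Ω) := Measure.prod_restrict _ _
    rw [this]
    filter_upwards [ae_restrict_mem (hm.prod hm)] with p hp
    rcases eq_or_ne p.1 p.2 with h | h
    · simp [h]
    have hpos : 0 < ‖p.1 - p.2‖ := norm_pos_iff.2 (sub_ne_zero.2 h)
    rw [mul_div_left_comm]
    refine le_mul_of_one_le_right (by positivity) ?_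
    rw [one_le_div (by positivity)]
    refine Real.rpow_le_rpow hpos.le ?_ (by positivity)
    rw [← dist_eq_norm]
    exact (hD hp.1 hp.2).trans (le_max_left _ _)
  have hw := (hu.sub_const ((∫ y in Ω, u y) / V)).1
  refine le_of_sq_le_sq ?_ (by have := gagliardo_nonneg s Ω u; positivity)
  rw [normL_two_sq hw, mul_pow, Real.sq_sqrt (by positivity), div_mul_eq_mul_div,
    le_div_iff₀ (by positivity)]
  linarith

/-! ### Interior balls near the points of a smooth domain -/

/-- A uniform interior corkscrew condition for the points of `Ω ∩ S`. -/
def CorkscrewOn {n : ℕ} (Ω S : Set (Rn n)) : Prop :=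
  ∃ κ > 0, ∃ R > 0, ∀ x ∈ Ω ∩ S, ∀ r, 0 < r → r ≤ R →
    ∃ z, Metric.ball z (κ * r) ⊆ Ω ∩ Metric.ball x r

theorem CorkscrewOn.mono {n : ℕ} {Ω S T : Set (Rn n)} (h : S ⊆ T) (hT : CorkscrewOn Ω T) :
    CorkscrewOn Ω S := by
  obtain ⟨κ, hκ, R, hR, H⟩ := hT
  exact ⟨κ, hκ, R, hR, fun x hx => H x ⟨hx.1, h hx.2⟩⟩

theorem CorkscrewOn.union {n : ℕ} {Ω S T : Set (Rn n)} (hS : CorkscrewOn Ω S)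
    (hT : CorkscrewOn Ω T) : CorkscrewOn Ω (S ∪ T) := by
  obtain ⟨κ, hκ, R, hR, H⟩ := hS
  obtain ⟨κ', hκ', R', hR', H'⟩ := hT
  refine ⟨min κ κ', lt_min hκ hκ', min R R', lt_min hR hR', fun x hx r hr hrR => ?_⟩
  rcases hx with ⟨hx, hx' | hx'⟩
  · obtain ⟨z, hz⟩ := H x ⟨hx, hx'⟩ r hr (hrR.trans (min_le_left _ _))
    exact ⟨z, (Metric.ball_subset_ball (by gcongr; exact min_le_left _ _)).trans hz⟩
  · obtain ⟨z, hz⟩ := H' x ⟨hx, hx'⟩ r hr (hrR.trans (min_le_right _ _))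
    exact ⟨z, (Metric.ball_subset_ball (by gcongr; exact min_le_right _ _)).trans hz⟩

theorem corkscrewOn_nhds_of_mem {n : ℕ} {Ω : Set (Rn n)} (hΩ : IsOpen Ω) {x₀ : Rn n}
    (hx₀ : x₀ ∈ Ω) : ∃ t ∈ 𝓝 x₀, CorkscrewOn Ω t := by
  obtain ⟨δ, hδ, hb⟩ := Metric.isOpen_iff.1 hΩ x₀ hx₀
  refine ⟨Metric.ball x₀ (δ / 2), Metric.ball_mem_nhds _ (by positivity), 1, one_pos, δ / 2,
    by positivity, fun x hx r _ hrR => ⟨x, ?_⟩⟩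
  rw [one_mul]
  refine Set.subset_inter (fun y hy => hb ?_) le_rfl
  have h1 := hx.2
  rw [Metric.mem_ball] at *
  linarith [dist_triangle y x x₀]

/-- Moving from `x` by `r / 2` along a unit vector on which the differential is `-a < 0` lowers `ρ`
by about `a r / 2`, which leaves room for a ball of radius proportional to `r`. Strict
differentiability makes this uniform in the base point `x` near `x₀`. -/
theorem corkscrewOn_nhds_of_smooth {n : ℕ} {Ω U : Set (Rn n)} {x₀ : Rn n} (hU : U ∈ 𝓝 x₀)
    {ρ : Rn n → ℝ} (hρ : ContDiff ℝ ∞ ρ) (hd : fderiv ℝ ρ x₀ ≠ 0)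
    (hΩ : ∀ y ∈ U, (y ∈ Ω ↔ ρ y < 0)) : ∃ t ∈ 𝓝 x₀, CorkscrewOn Ω t := by
  set L := fderiv ℝ ρ x₀ with hL
  obtain ⟨v, hv1, hv⟩ : ∃ v : Rn n, ‖v‖ = 1 ∧ L v < 0 := by
    obtain ⟨w, hw⟩ : ∃ w, L w < 0 := by
      by_contra! h
      refine hd (ContinuousLinearMap.ext fun w => le_antisymm ?_ (h w))
      have := h (-w)
      rw [map_neg] at this
      simpa using this
    have hw0 : w ≠ 0 := by rintro rfl; simp at hw
    have hwn : 0 < ‖w‖ := norm_pos_iff.2 hw0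
    refine ⟨‖w‖⁻¹ • w, norm_smul_inv_norm hw0, ?_⟩
    rw [map_smul, smul_eq_mul]
    exact mul_neg_of_pos_of_neg (by positivity) hw
  set a := -L v with ha
  have ha0 : 0 < a := by linarith
  have hstrict : HasStrictFDerivAt ρ L x₀ :=
    hρ.contDiffAt.hasStrictFDerivAt (by simp)
  have hev := hstrict.isLittleO.def (show (0 : ℝ) < a / 8 by positivity)
  obtain ⟨δ₁, hδ₁, h1⟩ := Metric.eventually_nhds_iff.1 hev
  obtain ⟨δ₂, hδ₂, h2⟩ := Metric.mem_nhds_iff.1 hU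
  set δ := min δ₁ δ₂
  have hδ : 0 < δ := lt_min hδ₁ hδ₂
  -- `η ≤ 1` keeps the ball within `r` of `x`; the other bound limits the variation of `L` on it to
  -- `a r / 8`. With the linearisation error below `a r / 8`, the drop `a r / 2` prevails.
  set η := min 1 (a / (4 * (‖L‖ + 1)))
  have hη : 0 < η := lt_min one_pos (by positivity)
  have hη1 : η ≤ 1 := min_le_left _ _
  have hηL : ‖L‖ * η ≤ a / 4 := by
    have : η ≤ a / (4 * (‖L‖ + 1)) := min_le_right _ _
    rw [le_div_iff₀ (by positivity)] at this
    nlinarith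
  refine ⟨Metric.ball x₀ (δ / 2), Metric.ball_mem_nhds _ (by positivity), η / 2, by positivity,
    δ / 2, by positivity, fun x hx r hr hrR => ⟨x + (r / 2) • v, fun y hy => ?_⟩⟩
  have hxδ : dist x x₀ < δ / 2 := hx.2
  have hy' : ‖y - x - (r / 2) • v‖ < η * r / 2 := by
    rw [Metric.mem_ball, dist_eq_norm, ← sub_sub] at hy
    linarith
  have htv : ‖(r / 2) • v‖ = r / 2 := by
    rw [norm_smul, hv1, mul_one, Real.norm_of_nonneg (by positivity)]
  have hyx : ‖y - x‖ < r := by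
    have := norm_add_le (y - x - (r / 2) • v) ((r / 2) • v)
    rw [sub_add_cancel, htv] at this
    nlinarith
  have hyx' : dist y x < r := by rwa [dist_eq_norm]
  have hyδ : dist y x₀ < δ := by linarith [dist_triangle y x x₀]
  refine ⟨?_, hyx'⟩
  have hxU : x ∈ U := h2 (lt_of_lt_of_le (by linarith : dist x x₀ < δ) (min_le_right _ _))
  have hyU : y ∈ U := h2 (lt_of_lt_of_le hyδ (min_le_right _ _))
  have hρx : ρ x < 0 := (hΩ x hxU).1 hx.1
  have hst := @h1 (y, x) (by
    rw [Prod.dist_eq]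
    exact max_lt (hyδ.trans_le (min_le_left _ _))
      ((by linarith : dist x x₀ < δ).trans_le (min_le_left _ _)))
  simp only [Real.norm_eq_abs] at hst
  have hst' := (abs_le.1 hst).2
  have hLy : L (y - x) ≤ -(3 / 8) * a * r := by
    have e : L (y - x) = L (y - x - (r / 2) • v) + (r / 2) * L v := by
      rw [← smul_eq_mul, ← map_smul, ← map_add, sub_add_cancel]
    have hle : L (y - x - (r / 2) • v) ≤ ‖L‖ * (η * r / 2) :=
      (le_abs_self _).trans ((L.le_opNorm _).trans (by gcongr))
    rw [e]
    nlinarith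
  rw [hΩ y hyU]
  nlinarith

/-- The condition is local and stable under finite unions, so compactness of the closure makes the
constants uniform. -/
theorem IsBoundedSmoothDomain.corkscrew {n : ℕ} {Ω : Set (Rn n)}
    (hΩ : IsBoundedSmoothDomain Ω) : CorkscrewOn Ω (closure Ω) := by
  have hc : IsCompact (closure Ω) := hΩ.isBounded.isCompact_closure
  refine hc.induction_on (p := CorkscrewOn Ω) ⟨1, one_pos, 1, one_pos, by simp⟩
    (fun _ _ h hT => hT.mono h) (fun _ _ => CorkscrewOn.union) fun x hx => ?_
  suffices ∃ t ∈ 𝓝 x, CorkscrewOn Ω t by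
    obtain ⟨t, ht, h⟩ := this
    exact ⟨t, mem_nhdsWithin_of_mem_nhds ht, h⟩
  by_cases hxΩ : x ∈ Ω
  · exact corkscrewOn_nhds_of_mem hΩ.isOpen hxΩ
  · obtain ⟨U, hU, ρ, hρ, hd, h⟩ := hΩ.smooth_boundary x
      ⟨hx, by rwa [hΩ.isOpen.interior_eq]⟩
    exact corkscrewOn_nhds_of_smooth hU hρ hd h

/-! ### The embedding into `L^q` by self-improvement -/

/-- The inner integral `∫_Ω (w x - w y)² / |x - y|^(n + 2s) dy` of the Gagliardo seminorm. -/
noncomputable def gagliardoDensity {n : ℕ} (s : ℝ) (Ω : Set (Rn n)) (w : Rn n → ℝ) (x : Rn n) :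
    ℝ≥0∞ :=
  ∫⁻ y in Ω, ENNReal.ofReal ((w x - w y) ^ 2 / ‖x - y‖ ^ ((n : ℝ) + 2 * s))

theorem lintegral_gagliardoDensity {n : ℕ} {s : ℝ} {Ω : Set (Rn n)} {w : Rn n → ℝ}
    (hw : MemHs s Ω w) :
    ∫⁻ x in Ω, gagliardoDensity s Ω w x = ENNReal.ofReal (gagliardo s Ω w ^ 2) := by
  have hi := gagliardo_integrable hw
  rw [gagliardo_sq, ofReal_integral_eq_lintegral_ofReal hi
    (Eventually.of_forall fun _ => by positivity), prodMeasure, lintegral_prod]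
  · rfl
  · exact hi.1.aemeasurable.ennreal_ofReal

/-- Within distance `r` of `x`, inserting the kernel costs at most a factor `r^(n+2s)`, whose square
root appears here. -/
theorem eLpNorm_sub_ball_le {n : ℕ} {s : ℝ} (hs : 0 < s) {Ω E : Set (Rn n)} {w : Rn n → ℝ}
    {x : Rn n} {r g : ℝ} (hr : 0 < r) (hg : 0 ≤ g) (hE : MeasurableSet E) (hEΩ : E ⊆ Ω)
    (hEr : E ⊆ Metric.ball x r) (hG : gagliardoDensity s Ω w x = ENNReal.ofReal (g ^ 2)) :
    eLpNorm (fun y => w x - w y) 2 (volume.restrict E) ≤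
      ENNReal.ofReal (r ^ ((n : ℝ) / 2 + s) * g) := by
  rw [eLpNorm_eq_lintegral_rpow_enorm_toReal (by norm_num) (by norm_num)]
  have h1 : ∫⁻ y in E, ‖w x - w y‖ₑ ^ (2 : ℝ≥0∞).toReal ≤
      ENNReal.ofReal ((r ^ ((n : ℝ) / 2 + s) * g) ^ 2) := by
    calc ∫⁻ y in E, ‖w x - w y‖ₑ ^ (2 : ℝ≥0∞).toReal
        ≤ ∫⁻ y in E, ENNReal.ofReal (r ^ ((n : ℝ) + 2 * s)) *
            ENNReal.ofReal ((w x - w y) ^ 2 / ‖x - y‖ ^ ((n : ℝ) + 2 * s)) := by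
          refine setLIntegral_mono_ae' hE (Eventually.of_forall fun y hy => ?_)
          rw [ENNReal.toReal_ofNat, ENNReal.rpow_ofNat, Real.enorm_eq_ofReal_abs,
            ← ENNReal.ofReal_pow (abs_nonneg _), sq_abs, ← ENNReal.ofReal_mul (by positivity)]
          refine ENNReal.ofReal_le_ofReal ?_
          rcases eq_or_ne x y with h | h
          · simp [h]
          have hpos : 0 < ‖x - y‖ := norm_pos_iff.2 (sub_ne_zero.2 h)
          rw [mul_div_left_comm]
          refine le_mul_of_one_le_right (by positivity) ?_
          rw [one_le_div (by positivity)]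
          refine Real.rpow_le_rpow hpos.le ?_ (by positivity)
          rw [← dist_eq_norm, dist_comm]
          exact (hEr hy).le
      _ = ENNReal.ofReal (r ^ ((n : ℝ) + 2 * s)) *
            ∫⁻ y in E, ENNReal.ofReal ((w x - w y) ^ 2 / ‖x - y‖ ^ ((n : ℝ) + 2 * s)) :=
          lintegral_const_mul' _ _ ENNReal.ofReal_ne_top
      _ ≤ ENNReal.ofReal (r ^ ((n : ℝ) + 2 * s)) * gagliardoDensity s Ω w x := by
          gcongr
          exact lintegral_mono_set hEΩ
      _ = _ := by
          rw [hG, ← ENNReal.ofReal_mul (by positivity), mul_pow, ← Real.rpow_natCast (r ^ _),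
            ← Real.rpow_mul hr.le]
          congr 3
          push_cast
          ring
  calc _ ≤ (ENNReal.ofReal ((r ^ ((n : ℝ) / 2 + s) * g) ^ 2)) ^ (1 / (2 : ℝ≥0∞).toReal) := by
        gcongr
    _ = _ := by
        rw [ENNReal.ofReal_rpow_of_nonneg (by positivity) (by simp), ENNReal.toReal_ofNat,
          ← Real.sqrt_eq_rpow, Real.sqrt_sq (by positivity)]

/-- Pointwise bound at a point `x` in terms of a nearby set `E` of positive measure. -/
theorem abs_mul_volume_le {n : ℕ} {s : ℝ} (hs : 0 < s) {Ω E : Set (Rn n)} {w : Rn n → ℝ}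
    (hw : AEStronglyMeasurable w (volume.restrict Ω)) {p : ℝ} (hp : 1 ≤ p)
    {x : Rn n} {r g A : ℝ} (hr : 0 < r) (hg : 0 ≤ g) (hA : 0 ≤ A)
    (hE : MeasurableSet E) (hEΩ : E ⊆ Ω)
    (hEr : E ⊆ Metric.ball x r) (hG : gagliardoDensity s Ω w x = ENNReal.ofReal (g ^ 2))
    (hwA : eLpNorm w (ENNReal.ofReal p) (volume.restrict Ω) ≤ ENNReal.ofReal A)
    {V : ℝ} (hV : 0 < V) (hEV : volume E = ENNReal.ofReal V) :
    |w x| ≤ V ^ (-(1 / 2) : ℝ) * (r ^ ((n : ℝ) / 2 + s) * g) + V ^ (-(1 / p)) * A := by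
  have hwE : AEStronglyMeasurable w (volume.restrict E) :=
    hw.mono_measure (Measure.restrict_mono hEΩ le_rfl)
  have hd : AEStronglyMeasurable (fun y => w x - w y) (volume.restrict E) :=
    aestronglyMeasurable_const.sub hwE
  have hu : (volume.restrict E) Set.univ = ENNReal.ofReal V := by simp [hEV]
  -- Split the constant `w x` as `(w x - w y) + w y` on `E`; Hölder then bounds the two `L¹` norms
  -- by the `L²` and `L^p` norms.
  have h1 : eLpNorm (fun _ => w x) 1 (volume.restrict E) ≤
      eLpNorm (fun y => w x - w y) 1 (volume.restrict E) + eLpNorm w 1 (volume.restrict E) := by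
    refine le_trans (le_of_eq ?_) (eLpNorm_add_le hd hwE le_rfl)
    congr 1
    funext y
    simp
  have h2 := eLpNorm_le_eLpNorm_mul_rpow_measure_univ (p := 1) (q := 2) (by norm_num) hd
  have h3 := eLpNorm_le_eLpNorm_mul_rpow_measure_univ (p := 1) (q := ENNReal.ofReal p)
    (by simpa using hp) hwE
  have h4 := eLpNorm_sub_ball_le hs hr hg hE hEΩ hEr hG
  have h5 : eLpNorm w (ENNReal.ofReal p) (volume.restrict E) ≤ ENNReal.ofReal A :=
    (eLpNorm_mono_measure _ (Measure.restrict_mono hEΩ le_rfl)).trans hwA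
  have h6 : eLpNorm (fun _ : Rn n => w x) 1 (volume.restrict E) = ENNReal.ofReal (|w x| * V) := by
    rw [eLpNorm_one_eq_lintegral_enorm, lintegral_const, hu, Real.enorm_eq_ofReal_abs,
      ENNReal.ofReal_mul (abs_nonneg _)]
  rw [hu, ENNReal.ofReal_rpow_of_pos hV] at h2 h3
  rw [h6] at h1
  have h7 : ENNReal.ofReal (|w x| * V) ≤ ENNReal.ofReal
      (r ^ ((n : ℝ) / 2 + s) * g * V ^ (1 / (1 : ℝ≥0∞).toReal - 1 / (2 : ℝ≥0∞).toReal) +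
        A * V ^ (1 / (1 : ℝ≥0∞).toReal - 1 / (ENNReal.ofReal p).toReal)) := by
    rw [ENNReal.ofReal_add (by positivity) (by positivity),
      ENNReal.ofReal_mul (p := r ^ ((n : ℝ) / 2 + s) * g) (by positivity),
      ENNReal.ofReal_mul (p := A) hA]
    exact h1.trans (add_le_add (h2.trans (mul_le_mul_left h4 _)) (h3.trans (mul_le_mul_left h5 _)))
  rw [ENNReal.ofReal_le_ofReal_iff (by positivity), ENNReal.toReal_one, ENNReal.toReal_ofNat,
    ENNReal.toReal_ofReal (by linarith)] at h7
  rw [← mul_le_mul_iff_left₀ hV]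
  refine h7.trans (le_of_eq ?_)
  have e (a : ℝ) : V ^ (1 / 1 - a) = V ^ (-a) * V := by
    rw [← Real.rpow_add_one hV.ne']; congr 1; ring
  rw [e, e]
  ring

/-- Optimisation over the radius in a two-term pointwise bound. -/
theorem rpow_le_of_forall_radius {d s p R K₁ K₂ a g A : ℝ} (hd : 0 < d) (hs : 0 < s) (hp : 0 < p)
    (hR : 0 < R) (hK₁ : 0 ≤ K₁) (hK₂ : 0 ≤ K₂) (ha : 0 ≤ a) (hA : 0 < A)
    (h : ∀ r, 0 < r → r ≤ R → a ≤ K₁ * (r ^ s * g) + K₂ * (r ^ (-(d / p)) * A)) :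
    a ^ (2 + 2 * s * p / d) ≤
      ((K₁ * R ^ s + K₂ * R ^ (-(d / p))) * A) ^ (2 + 2 * s * p / d) * (1 + g ^ 2 / A ^ 2) := by
  -- The radius will be `R t^(-β)`, at most `R` as `t ≥ 1`. This `β` balances the two terms: both
  -- scale as `t^θ`, and the final exponent is `2 / θ`, leaving `t² ≤ 1 + g² / A²`.
  set t := max 1 (g / A)
  have ht : 1 ≤ t := le_max_left _ _
  have ht0 : 0 < t := by linarith
  have hgt : g ≤ t * A := by
    rw [← div_le_iff₀ hA]; exact le_max_right _ _
  have hnp : 0 < d + s * p := by positivity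
  set θ := d / (d + s * p)
  set β := p / (d + s * p)
  have hβ : 0 < β := by positivity
  have e1 : -β * s + 1 = θ := by simp only [β, θ]; field_simp; ring
  have e2 : -β * -(d / p) = θ := by simp only [β, θ]; field_simp
  have e3 : θ * (2 + 2 * s * p / d) = 2 := by simp only [θ]; field_simp
  have hb := h (R * t ^ (-β)) (by positivity)
    (mul_le_of_le_one_right hR.le (Real.rpow_le_one_of_one_le_of_nonpos ht (by linarith)))
  rw [Real.mul_rpow hR.le (by positivity), Real.mul_rpow hR.le (by positivity),
    ← Real.rpow_mul ht0.le, ← Real.rpow_mul ht0.le, e2] at hb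
  have hb2 : R ^ s * t ^ (-β * s) * g ≤ R ^ s * (t ^ θ * A) := by
    calc R ^ s * t ^ (-β * s) * g ≤ R ^ s * t ^ (-β * s) * (t * A) := by gcongr
      _ = R ^ s * ((t ^ (-β * s) * t) * A) := by ring
      _ = _ := by rw [← Real.rpow_add_one ht0.ne', e1]
  have hb3 : a ≤ ((K₁ * R ^ s + K₂ * R ^ (-(d / p))) * A) * t ^ θ := by
    have := mul_le_mul_of_nonneg_left hb2 hK₁
    linarith
  calc a ^ (2 + 2 * s * p / d)
      ≤ (((K₁ * R ^ s + K₂ * R ^ (-(d / p))) * A) * t ^ θ) ^ (2 + 2 * s * p / d) := by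
        gcongr
    _ = ((K₁ * R ^ s + K₂ * R ^ (-(d / p))) * A) ^ (2 + 2 * s * p / d) * t ^ 2 := by
        rw [Real.mul_rpow (by positivity) (by positivity), ← Real.rpow_mul ht0.le, e3,
          Real.rpow_ofNat]
    _ ≤ _ := by
        gcongr
        rw [← div_pow]
        rcases max_choice 1 (g / A) with h | h
        · simp only [t, h]; nlinarith [sq_nonneg (g / A)]
        · simp only [t, h]; linarith

/-- The embedding `H^s(Ω) → L^p(Ω)`, with the norm of `H^s(Ω)` bounded by a positive number. -/
def EmbedsIn {n : ℕ} (s : ℝ) (Ω : Set (Rn n)) (p : ℝ) : Prop :=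
  ∃ C > 0, ∀ w, MemHs s Ω w → ∀ A > 0, gagliardo s Ω w ≤ A → normL 2 Ω w ≤ A →
    eLpNorm w (ENNReal.ofReal p) (volume.restrict Ω) ≤ ENNReal.ofReal (C * A)

theorem embedsIn_two {n : ℕ} (s : ℝ) (Ω : Set (Rn n)) : EmbedsIn s Ω 2 := by
  refine ⟨1, one_pos, fun w hw A hA _ h => ?_⟩
  rw [one_mul, ENNReal.le_ofReal_iff_toReal_le _ hA.le]
  · exact h
  · rw [ENNReal.ofReal_ofNat]; exact hw.1.2.ne

theorem EmbedsIn.mono {n : ℕ} {s : ℝ} {Ω : Set (Rn n)} [IsFiniteMeasure (volume.restrict Ω)]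
    {p q : ℝ} (hq : 0 < q) (hqp : q ≤ p) (h : EmbedsIn s Ω p) : EmbedsIn s Ω q := by
  obtain ⟨C, hC, H⟩ := h
  have hex : 0 ≤ 1 / (ENNReal.ofReal q).toReal - 1 / (ENNReal.ofReal p).toReal := by
    rw [ENNReal.toReal_ofReal hq.le, ENNReal.toReal_ofReal (hq.le.trans hqp), sub_nonneg]
    exact one_div_le_one_div_of_le hq hqp
  -- The `+ 1` keeps the constant positive even when `Ω` is null.
  refine ⟨C * ((volume.restrict Ω).real Set.univ + 1) ^
    (1 / (ENNReal.ofReal q).toReal - 1 / (ENNReal.ofReal p).toReal), by positivity,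
    fun w hw A hA h1 h2 => ?_⟩
  refine (eLpNorm_le_eLpNorm_mul_rpow_measure_univ
    (ENNReal.ofReal_le_ofReal hqp) hw.1.1).trans ?_
  rw [mul_right_comm, ENNReal.ofReal_mul (by positivity),
    ← ENNReal.ofReal_rpow_of_nonneg (by positivity) hex]
  gcongr
  · exact H w hw A hA h1 h2
  · rw [ENNReal.le_ofReal_iff_toReal_le (measure_ne_top _ _) (by positivity)]
    exact le_add_of_nonneg_right zero_le_one

/-- The exponent is the one for which the optimised pointwise bound on `|w|^P` is linear in the
Gagliardo density, whose integral is `[w]²`. -/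
theorem EmbedsIn.improve {n : ℕ} (hn : 1 ≤ n) {s : ℝ} (hs : 0 < s) {Ω : Set (Rn n)}
    (hΩ : MeasurableSet Ω) [IsFiniteMeasure (volume.restrict Ω)] (hc : CorkscrewOn Ω Ω) {p : ℝ}
    (hp : 1 ≤ p) (h : EmbedsIn s Ω p) : EmbedsIn s Ω (2 + 2 * s * p / n) := by
  obtain ⟨C, hC, H⟩ := h
  obtain ⟨κ, hκ, R, hR, Hc⟩ := hc
  have hn0 : (0 : ℝ) < n := by exact_mod_cast hn
  set υ := (volume (Metric.ball (0 : Rn n) 1)).toReal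
  have hυ : 0 < υ := ENNReal.toReal_pos (Metric.measure_ball_pos _ _ one_pos).ne'
    measure_ball_lt_top.ne
  set b := κ ^ n * υ
  have hb : 0 < b := by positivity
  set K₁ := b ^ (-(1 / 2) : ℝ)
  set K₂ := b ^ (-(1 / p))
  set K := K₁ * R ^ s + K₂ * R ^ (-((n : ℝ) / p))
  have hK : 0 < K := by positivity
  set P := 2 + 2 * s * p / n
  have hP : 0 < P := by positivity
  set V := (volume.restrict Ω).real Set.univ
  refine ⟨K * max C 1 * (V + 1) ^ (1 / P), by positivity, fun w hw A₀ hA₀ h1 h2 => ?_⟩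
  -- This `A` dominates both the `L^p` norm and the seminorm.
  set A := max C 1 * A₀
  have hA : 0 < A := by positivity
  have hCA : C * A₀ ≤ A := mul_le_mul_of_nonneg_right (le_max_left _ _) hA₀.le
  have hAA : A₀ ≤ A := le_mul_of_one_le_left hA₀.le (le_max_right _ _)
  have hwA : eLpNorm w (ENNReal.ofReal p) (volume.restrict Ω) ≤ ENNReal.ofReal A :=
    (H w hw A₀ hA₀ h1 h2).trans (ENNReal.ofReal_le_ofReal hCA)
  have hpt : ∀ x ∈ Ω, ‖w x‖ₑ ^ P ≤ ENNReal.ofReal ((K * A) ^ P) *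
      (1 + (ENNReal.ofReal (A ^ 2))⁻¹ * gagliardoDensity s Ω w x) := by
    intro x hx
    -- Where the density is infinite the bound is trivial.
    rcases eq_or_ne (gagliardoDensity s Ω w x) ⊤ with hG | hG
    · rw [hG, ENNReal.mul_top (by simp), add_top, ENNReal.mul_top (by positivity)]
      exact le_top
    set g := √(gagliardoDensity s Ω w x).toReal
    have hg : 0 ≤ g := Real.sqrt_nonneg _
    have hGg : gagliardoDensity s Ω w x = ENNReal.ofReal (g ^ 2) := by
      rw [Real.sq_sqrt ENNReal.toReal_nonneg, ENNReal.ofReal_toReal hG]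
    have key : |w x| ^ P ≤ (K * A) ^ P * (1 + g ^ 2 / A ^ 2) := by
      refine rpow_le_of_forall_radius hn0 hs (by linarith) hR (by positivity) (by positivity)
        (abs_nonneg _) hA fun r hr hrR => ?_
      obtain ⟨z, hz⟩ := Hc x ⟨hx, hx⟩ r hr hrR
      have hvol : volume (Metric.ball z (κ * r)) = ENNReal.ofReal (b * r ^ n) := by
        rw [Measure.addHaar_ball_of_pos _ _ (by positivity), finrank_euclideanSpace_fin,
          ← ENNReal.ofReal_toReal (measure_ball_lt_top (x := (0 : Rn n)) (r := 1)).ne,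
          ← ENNReal.ofReal_mul (by positivity)]
        congr 1
        simp only [b, υ]
        ring
      have hx' := abs_mul_volume_le hs hw.1.1 hp hr hg hA.le Metric.isOpen_ball.measurableSet
        (hz.trans Set.inter_subset_left) (hz.trans Set.inter_subset_right) hGg hwA
        (by positivity) hvol
      refine hx'.trans (le_of_eq ?_)
      rw [Real.mul_rpow hb.le (by positivity), Real.mul_rpow hb.le (by positivity),
        ← Real.rpow_natCast, ← Real.rpow_mul hr.le, ← Real.rpow_mul hr.le]
      have e1 : r ^ ((n : ℝ) * -(1 / 2)) * r ^ ((n : ℝ) / 2 + s) = r ^ s := by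
        rw [← Real.rpow_add hr]; congr 1; ring
      have e2 : (n : ℝ) * -(1 / p) = -((n : ℝ) / p) := by ring
      rw [e2, ← e1]
      ring
    rw [hGg, Real.enorm_eq_ofReal_abs, ENNReal.ofReal_rpow_of_nonneg (abs_nonneg _) hP.le]
    refine (ENNReal.ofReal_le_ofReal key).trans (le_of_eq ?_)
    rw [ENNReal.ofReal_mul (by positivity), ENNReal.ofReal_add zero_le_one (by positivity),
      ENNReal.ofReal_one, ENNReal.ofReal_div_of_pos (by positivity), ENNReal.div_eq_inv_mul]
  have hint : ∫⁻ x in Ω, ‖w x‖ₑ ^ P ≤ ENNReal.ofReal ((K * A) ^ P * (V + 1)) := by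
    calc ∫⁻ x in Ω, ‖w x‖ₑ ^ P
        ≤ ∫⁻ x in Ω, ENNReal.ofReal ((K * A) ^ P) *
            (1 + (ENNReal.ofReal (A ^ 2))⁻¹ * gagliardoDensity s Ω w x) :=
          setLIntegral_mono_ae' hΩ (Eventually.of_forall hpt)
      _ = ENNReal.ofReal ((K * A) ^ P) * (ENNReal.ofReal V +
            (ENNReal.ofReal (A ^ 2))⁻¹ * ENNReal.ofReal (gagliardo s Ω w ^ 2)) := by
          rw [lintegral_const_mul' _ _ ENNReal.ofReal_ne_top,
            lintegral_add_left measurable_const, lintegral_const_mul' _ _ (by simp [hA.ne']),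
            lintegral_gagliardoDensity hw, lintegral_const, one_mul,
            ofReal_measureReal]
      _ ≤ ENNReal.ofReal ((K * A) ^ P) * (ENNReal.ofReal V + 1) := by
          gcongr
          rw [← ENNReal.div_eq_inv_mul]
          refine ENNReal.div_le_of_le_mul ?_
          rw [one_mul]
          gcongr
          exacts [gagliardo_nonneg _ _ _, h1.trans hAA]
      _ = _ := by
          rw [ENNReal.ofReal_mul (by positivity), ENNReal.ofReal_add (by positivity) zero_le_one,
            ENNReal.ofReal_one]
  rw [eLpNorm_eq_lintegral_rpow_enorm_toReal (by positivity) ENNReal.ofReal_ne_top,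
    ENNReal.toReal_ofReal hP.le]
  calc (∫⁻ x in Ω, ‖w x‖ₑ ^ P) ^ (1 / P)
      ≤ (ENNReal.ofReal ((K * A) ^ P * (V + 1))) ^ (1 / P) := by gcongr
    _ = _ := by
      rw [ENNReal.ofReal_rpow_of_nonneg (by positivity) (by positivity),
        Real.mul_rpow (by positivity) (by positivity), ← Real.rpow_mul (by positivity),
        mul_one_div_cancel hP.ne', Real.rpow_one]
      congr 1
      simp only [A]
      ring

/-- When `2s < n`, the critical exponent is the fixed point of `p ↦ 2 + 2sp/n`. On `[2, q]` each
step gains at least a fixed `δ`, so finitely many steps from `p = 2` pass `q`. -/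
theorem embedsIn_of_lt_critExp {n : ℕ} (hn : 1 ≤ n) {s : ℝ} (hs : 0 < s) {Ω : Set (Rn n)}
    (hΩ : MeasurableSet Ω) [IsFiniteMeasure (volume.restrict Ω)] (hc : CorkscrewOn Ω Ω) {q : ℝ}
    (hq1 : 1 ≤ q) (hq : ENNReal.ofReal q < critExp n s) : EmbedsIn s Ω q := by
  have hn0 : (0 : ℝ) < n := by exact_mod_cast hn
  obtain ⟨δ, hδ, hstep⟩ : ∃ δ > 0, ∀ p, 2 ≤ p → p ≤ q → p + δ ≤ 2 + 2 * s * p / n := by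
    by_cases h : 2 * s < n
    · have hq' : q < 2 * n / (n - 2 * s) := by
        rw [critExp, if_pos h] at hq
        exact (ENNReal.ofReal_lt_ofReal_iff_of_nonneg (by linarith)).1 hq
      have hns : 0 < (n : ℝ) - 2 * s := by linarith
      rw [lt_div_iff₀ hns] at hq'
      -- The gain `(2n - p(n - 2s)) / n` decreases in `p`, so its least value is at `p = q`.
      refine ⟨(2 * n - q * (n - 2 * s)) / n, div_pos (by linarith) hn0, fun p hp hpq => ?_⟩
      rw [← mul_le_mul_iff_left₀ hn0, add_mul, add_mul, div_mul_cancel₀ _ hn0.ne',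
        div_mul_cancel₀ _ hn0.ne']
      nlinarith
    · refine ⟨2, two_pos, fun p hp _ => ?_⟩
      have : p ≤ 2 * s * p / n := by
        rw [le_div_iff₀ hn0]
        nlinarith
      linarith
  have hiter : ∀ k : ℕ, ∃ p, 2 ≤ p ∧ EmbedsIn s Ω p ∧ (q ≤ p ∨ 2 + k * δ ≤ p) := by
    intro k
    induction k with
    | zero => exact ⟨2, le_rfl, embedsIn_two s Ω, Or.inr (by simp)⟩
    | succ k ih =>
      obtain ⟨p, hp, hE, h⟩ := ih
      rcases le_total q p with hqp | hqp
      · exact ⟨p, hp, hE, Or.inl hqp⟩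
      refine ⟨2 + 2 * s * p / n, le_add_of_nonneg_right (by positivity),
        hE.improve hn hs hΩ hc (by linarith), ?_⟩
      have h1 := hstep p hp hqp
      rcases h with h | h
      · exact Or.inl (by linarith)
      · exact Or.inr (by push_cast; linarith)
  obtain ⟨k, hk⟩ := exists_nat_gt (q / δ)
  obtain ⟨p, hp, hE, h⟩ := hiter k
  rw [div_lt_iff₀ hδ] at hk
  exact hE.mono (by linarith) (by rcases h with h | h <;> linarith)

/-! ### Means and the Poincaré–Sobolev inequality -/

theorem normL_add_le {n : ℕ} {r : ℝ} (hr : 1 ≤ r) {Ω : Set (Rn n)} {u v : Rn n → ℝ}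
    (hu : MemLp u (ENNReal.ofReal r) (volume.restrict Ω))
    (hv : MemLp v (ENNReal.ofReal r) (volume.restrict Ω)) :
    normL r Ω (fun x => u x + v x) ≤ normL r Ω u + normL r Ω v := by
  unfold normL
  rw [← ENNReal.toReal_add hu.2.ne hv.2.ne]
  exact ENNReal.toReal_mono (ENNReal.add_ne_top.2 ⟨hu.2.ne, hv.2.ne⟩)
    (eLpNorm_add_le hu.1 hv.1 (by simpa using hr))

theorem normL_neg {n : ℕ} (r : ℝ) (Ω : Set (Rn n)) (u : Rn n → ℝ) :
    normL r Ω (fun x => -u x) = normL r Ω u :=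
  congrArg ENNReal.toReal (eLpNorm_neg u _ _)

theorem normL_const {n : ℕ} {r : ℝ} (hr : 0 < r) (Ω : Set (Rn n)) (c : ℝ) :
    normL r Ω (fun _ => c) = |c| * (volume Ω).toReal ^ (1 / r) := by
  unfold normL
  rw [eLpNorm_const' c (by simpa using hr) ENNReal.ofReal_ne_top, ENNReal.toReal_mul,
    ← ENNReal.toReal_rpow, ENNReal.toReal_ofReal hr.le, Measure.restrict_apply_univ,
    toReal_enorm, Real.norm_eq_abs]

theorem normL_le_normL_sub_const_add {n : ℕ} {r : ℝ} (hr : 1 ≤ r) {Ω : Set (Rn n)}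
    [IsFiniteMeasure (volume.restrict Ω)] {v : Rn n → ℝ}
    (hv : MemLp v (ENNReal.ofReal r) (volume.restrict Ω)) (m : ℝ) :
    normL r Ω v ≤ normL r Ω (fun x => v x - m) + |m| * (volume Ω).toReal ^ (1 / r) := by
  have hw : MemLp (fun x => v x - m) (ENNReal.ofReal r) (volume.restrict Ω) :=
    hv.sub (memLp_const m)
  rw [← normL_const (by linarith)]
  simpa using normL_add_le hr hw (memLp_const m)

theorem abs_mul_le_normL_add {n : ℕ} {r : ℝ} (hr : 1 ≤ r) {Ω : Set (Rn n)}
    [IsFiniteMeasure (volume.restrict Ω)] {v : Rn n → ℝ}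
    (hv : MemLp v (ENNReal.ofReal r) (volume.restrict Ω)) (m : ℝ) :
    |m| * (volume Ω).toReal ^ (1 / r) ≤ normL r Ω v + normL r Ω (fun x => v x - m) := by
  have hw : MemLp (fun x => -(v x - m)) (ENNReal.ofReal r) (volume.restrict Ω) :=
    (hv.sub (memLp_const m)).neg
  rw [← normL_const (by linarith), ← normL_neg r Ω (fun x => v x - m)]
  simpa using normL_add_le hr hv hw

/-- The mean value of `v` over `Ω`. -/
noncomputable def mean {n : ℕ} (Ω : Set (Rn n)) (v : Rn n → ℝ) : ℝ :=
  (∫ y in Ω, v y) / (volume Ω).toReal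

/-- The sign by which `v` is normalised to have nonnegative mean. -/
noncomputable def meanSign {n : ℕ} (Ω : Set (Rn n)) (v : Rn n → ℝ) : ℝ :=
  if 0 ≤ mean Ω v then 1 else -1

theorem meanSign_eq_or {n : ℕ} (Ω : Set (Rn n)) (v : Rn n → ℝ) :
    meanSign Ω v = 1 ∨ meanSign Ω v = -1 := by
  unfold meanSign
  split_ifs <;> simp

theorem meanSign_mul_mean {n : ℕ} (Ω : Set (Rn n)) (v : Rn n → ℝ) :
    meanSign Ω v * mean Ω v = |mean Ω v| := by
  unfold meanSign
  split_ifs with h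
  · rw [one_mul, abs_of_nonneg h]
  · rw [neg_one_mul, abs_of_neg (not_le.1 h)]

/-- The fractional Poincaré–Sobolev inequality, in `L²` and in `L^q`. -/
theorem poincare_sobolev {n : ℕ} (hn : 1 ≤ n) {s : ℝ} (hs : 0 < s) {Ω : Set (Rn n)}
    (hm : MeasurableSet Ω) (hb : Bornology.IsBounded Ω) [IsFiniteMeasure (volume.restrict Ω)]
    (hV : 0 < (volume Ω).toReal) (hc : CorkscrewOn Ω Ω) {q : ℝ}
    (hq1 : 1 ≤ q) (hq : ENNReal.ofReal q < critExp n s) :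
    ∃ C > 0, ∀ v, MemHs s Ω v → MemLp v (ENNReal.ofReal q) (volume.restrict Ω) ∧
      normL 2 Ω (fun x => v x - mean Ω v) ≤ C * gagliardo s Ω v ∧
      normL q Ω (fun x => v x - mean Ω v) ≤ C * gagliardo s Ω v := by
  obtain ⟨C₁, hC₁, H₁⟩ := poincare hs hm hb hV
  obtain ⟨C₂, hC₂, H₂⟩ := embedsIn_of_lt_critExp hn hs hm hc hq1 hq
  -- With this constant `C₃ [v]` bounds both the seminorm and the `L²` norm of `v - mean`.
  set C₃ := max 1 C₁
  have h3 : 1 ≤ C₃ := le_max_left _ _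
  refine ⟨max C₁ (C₂ * C₃), by positivity, fun v hv => ?_⟩
  have hg := gagliardo_nonneg s Ω v
  have hw := hv.sub_const (mean Ω v)
  have h1 : normL 2 Ω (fun x => v x - mean Ω v) ≤ C₁ * gagliardo s Ω v := H₁ v hv
  -- `EmbedsIn` asks for a strictly positive bound; the slack `δ` covers `[v] = 0` and is removed at
  -- the end.
  have hbd : ∀ δ > 0, eLpNorm (fun x => v x - mean Ω v) (ENNReal.ofReal q) (volume.restrict Ω) ≤
      ENNReal.ofReal (C₂ * (C₃ * gagliardo s Ω v + δ)) := fun δ hδ => by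
    refine H₂ _ hw _ (by positivity) ?_ (h1.trans ?_)
    · rw [gagliardo_sub_const]; nlinarith
    · have : C₁ * gagliardo s Ω v ≤ C₃ * gagliardo s Ω v :=
        mul_le_mul_of_nonneg_right (le_max_right _ _) hg
      linarith
  have hwq : MemLp (fun x => v x - mean Ω v) (ENNReal.ofReal q) (volume.restrict Ω) :=
    ⟨hw.1.1, (hbd 1 one_pos).trans_lt ENNReal.ofReal_lt_top⟩
  refine ⟨?_, h1.trans (mul_le_mul_of_nonneg_right (le_max_left _ _) hg),
    le_trans ?_ (mul_le_mul_of_nonneg_right (le_max_right _ _) hg)⟩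
  · refine (hwq.add (memLp_const (mean Ω v))).ae_eq (Eventually.of_forall fun x => ?_)
    simp
  · refine le_of_forall_pos_le_add fun δ hδ => ?_
    have h := ENNReal.toReal_le_of_le_ofReal (by positivity) (hbd (δ / C₂) (by positivity))
    refine h.trans (le_of_eq ?_)
    field_simp

/-! ### The rescaled quotient and two-sided bounds -/

/-- The norm `v ↦ (ε^(-2s) [v]² + ‖v‖₂²)^(1/2)`, squared, to which the norm of `H^s(ε Ω)`
rescales. -/
noncomputable def scaledEnergy {n : ℕ} (s ε : ℝ) (Ω : Set (Rn n)) (v : Rn n → ℝ) : ℝ :=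
  ε ^ (-(2 * s)) * gagliardo s Ω v ^ 2 + normL 2 Ω v ^ 2

theorem quotient_smul_set {n : ℕ} {s q ε : ℝ} (hε : 0 < ε) (hq : 0 < q) (Ω : Set (Rn n))
    (u : Rn n → ℝ) :
    quotient s q (ε • Ω) u = ε ^ ((n : ℝ) * (1 - 2 / q)) *
      (scaledEnergy s ε Ω (rescale ε u) / normL q Ω (rescale ε u) ^ 2) := by
  rw [quotient, normHs_sq, gagliardo_sq_smul_set hε, normL_smul_set hε two_pos,
    normL_smul_set hε hq, mul_pow, mul_pow, scaledEnergy, ← Real.rpow_natCast (ε ^ _),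
    ← Real.rpow_natCast (ε ^ _), ← Real.rpow_mul hε.le, ← Real.rpow_mul hε.le]
  have e1 : ε ^ ((n : ℝ) - 2 * s) = ε ^ (n : ℝ) * ε ^ (-(2 * s)) := by
    rw [← Real.rpow_add hε]; congr 1
  have e2 : (n : ℝ) / 2 * (2 : ℕ) = n := by push_cast; ring
  have e3 : ε ^ ((n : ℝ) * (1 - 2 / q)) = ε ^ (n : ℝ) / ε ^ ((n : ℝ) / q * (2 : ℕ)) := by
    rw [← Real.rpow_sub hε]; congr 1; push_cast; ring
  rw [e1, e2, e3, div_mul_div_comm]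
  congr 1
  ring

theorem gagliardo_const {n : ℕ} (s : ℝ) (Ω : Set (Rn n)) (c : ℝ) :
    gagliardo s Ω (fun _ => c) = 0 := by
  simp [gagliardo]

theorem quotient_nonneg {n : ℕ} (s q : ℝ) (Ω : Set (Rn n)) (u : Rn n → ℝ) :
    0 ≤ quotient s q Ω u := by
  unfold quotient; positivity

theorem memHsNonzero_one {n : ℕ} (s : ℝ) {Ω : Set (Rn n)} [IsFiniteMeasure (volume.restrict Ω)]
    (hV : volume Ω ≠ 0) : MemHsNonzero s Ω (fun _ => 1) := by
  refine ⟨⟨memLp_const 1, by simp⟩, fun h => hV ?_⟩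
  rw [← Measure.restrict_eq_zero, ← ae_eq_bot, ← eventually_false_iff_eq_bot]
  filter_upwards [h] with x hx
  simp at hx

/-- Test with the constant `1`, whose seminorm vanishes. -/
theorem sobolevConst_smul_set_le {n : ℕ} {s q ε : ℝ} (hε : 0 < ε) (hq : 0 < q) {Ω : Set (Rn n)}
    [IsFiniteMeasure (volume.restrict Ω)] (hV : 0 < (volume Ω).toReal) :
    sobolevConst s q (ε • Ω) / ε ^ ((n : ℝ) * (1 - 2 / q)) ≤
      (volume Ω).toReal ^ (1 - 2 / q) := by
  rw [div_le_iff₀' (by positivity)]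
  have hfin : volume (ε • Ω) ≠ ⊤ := by
    rw [Measure.addHaar_smul]
    exact ENNReal.mul_ne_top ENNReal.ofReal_ne_top (ENNReal.toReal_pos_iff.1 hV).2.ne
  have : IsFiniteMeasure ((volume : Measure (Rn n)).restrict (ε • Ω)) :=
    ⟨by rw [Measure.restrict_apply_univ]; exact hfin.lt_top⟩
  have hne : volume (ε • Ω) ≠ 0 := by
    rw [Measure.addHaar_smul]
    exact mul_ne_zero (by simp [hε.ne']) (ENNReal.toReal_pos_iff.1 hV).1.ne'
  have h1 : sobolevConst s q (ε • Ω) ≤ quotient s q (ε • Ω) (fun _ => 1) :=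
    csInf_le ⟨0, by rintro _ ⟨u, _, rfl⟩; exact quotient_nonneg _ _ _ _⟩
      ⟨_, memHsNonzero_one s hne, rfl⟩
  refine h1.trans (le_of_eq ?_)
  rw [quotient_smul_set hε hq]
  congr 1
  have : rescale ε (fun _ : Rn n => (1 : ℝ)) = fun _ => 1 := rfl
  rw [this, scaledEnergy, gagliardo_const, normL_const two_pos, normL_const hq, abs_one, one_mul,
    one_mul, ← Real.rpow_natCast (_ ^ _), ← Real.rpow_natCast (_ ^ _), ← Real.rpow_mul hV.le,
    ← Real.rpow_mul hV.le, zero_pow two_ne_zero, mul_zero, zero_add, ← Real.rpow_sub hV]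
  congr 1
  push_cast
  ring

/-- Pass through the mean: `‖v‖_q` is near `|m| |Ω|^(1/q)`, and `|m| |Ω|^(1/2)` is near `‖v‖₂`. The
coefficient of `‖v‖₂` is exact on constants, which is why the lower bound has the right limit. -/
theorem normL_le_normL_two_add {n : ℕ} {s : ℝ} {Ω : Set (Rn n)}
    [IsFiniteMeasure (volume.restrict Ω)] (hV : 0 < (volume Ω).toReal) {q : ℝ} (hq1 : 1 ≤ q)
    {C : ℝ} {v : Rn n → ℝ} (hv : MemHs s Ω v)
    (hvq : MemLp v (ENNReal.ofReal q) (volume.restrict Ω))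
    (h2 : normL 2 Ω (fun x => v x - mean Ω v) ≤ C * gagliardo s Ω v)
    (hq : normL q Ω (fun x => v x - mean Ω v) ≤ C * gagliardo s Ω v) :
    normL q Ω v ≤ (volume Ω).toReal ^ (1 / q - 1 / 2) * normL 2 Ω v +
      (C + (volume Ω).toReal ^ (1 / q - 1 / 2) * C) * gagliardo s Ω v := by
  set V := (volume Ω).toReal
  set m := mean Ω v with hm
  have hv2 : MemLp v (ENNReal.ofReal 2) (volume.restrict Ω) := by
    rw [ENNReal.ofReal_ofNat]; exact hv.1
  have t1 : normL q Ω v ≤ normL q Ω (fun x => v x - m) + |m| * V ^ (1 / q) :=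
    normL_le_normL_sub_const_add hq1 hvq m
  have t2 : |m| * V ^ ((1 : ℝ) / 2) ≤ normL 2 Ω v + normL 2 Ω (fun x => v x - m) :=
    abs_mul_le_normL_add one_le_two hv2 m
  have e : V ^ (1 / q) = V ^ (1 / q - 1 / 2) * V ^ ((1 : ℝ) / 2) := by
    rw [← Real.rpow_add hV]; congr 1; ring
  have t3 := mul_le_mul_of_nonneg_left (t2.trans (add_le_add_right h2 _))
    (show 0 ≤ V ^ (1 / q - 1 / 2) by positivity)
  rw [e] at t1
  linarith

/-- With `c = |Ω|^(-1/q)`, the normalisation forces `|m|` to be within `C c [v]` of `c`. Then `σ v -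
c = σ (v - m) + (|m| - c)` is a sum of two terms of order `[v]`. -/
theorem normHs_meanSign_mul_sub_le {n : ℕ} {s : ℝ} {Ω : Set (Rn n)}
    [IsFiniteMeasure (volume.restrict Ω)] (hV : 0 < (volume Ω).toReal) {q : ℝ} (hq1 : 1 ≤ q)
    {C : ℝ} {v : Rn n → ℝ} (hv : MemHs s Ω v)
    (hvq : MemLp v (ENNReal.ofReal q) (volume.restrict Ω))
    (h2 : normL 2 Ω (fun x => v x - mean Ω v) ≤ C * gagliardo s Ω v)
    (hq : normL q Ω (fun x => v x - mean Ω v) ≤ C * gagliardo s Ω v)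
    (h1 : normL q Ω v = 1) :
    normHs s Ω (fun x => meanSign Ω v * v x - (volume Ω).toReal ^ (-(1 / q))) ≤
      (1 + (C + C * (volume Ω).toReal ^ (-(1 / q)) * (volume Ω).toReal ^ ((1 : ℝ) / 2))) *
        gagliardo s Ω v := by
  set V := (volume Ω).toReal
  set m := mean Ω v with hm
  set σ := meanSign Ω v with hσ
  set c := V ^ (-(1 / q)) with hc
  have hσ2 : σ = 1 ∨ σ = -1 := meanSign_eq_or Ω v
  have hσm : σ * m = |m| := meanSign_mul_mean Ω v
  have hg := gagliardo_nonneg s Ω v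
  have t1 : normL q Ω v ≤ normL q Ω (fun x => v x - m) + |m| * V ^ (1 / q) :=
    normL_le_normL_sub_const_add hq1 hvq m
  have t2 : |m| * V ^ (1 / q) ≤ normL q Ω v + normL q Ω (fun x => v x - m) :=
    abs_mul_le_normL_add hq1 hvq m
  have hcV : V ^ (1 / q) * c = 1 := by
    rw [hc, ← Real.rpow_add hV, add_neg_cancel, Real.rpow_zero]
  have hc0 : 0 < c := by positivity
  have hmc : |(|m| - c)| ≤ C * gagliardo s Ω v * c := by
    have e : |m| - c = (|m| * V ^ (1 / q) - 1) * c := by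
      rw [sub_mul, mul_assoc, hcV]; ring
    rw [e, abs_mul, abs_of_pos hc0]
    gcongr
    rw [abs_le]
    constructor <;> linarith
  have hv2 : MemLp v (ENNReal.ofReal 2) (volume.restrict Ω) := by
    rw [ENNReal.ofReal_ofNat]; exact hv.1
  have hw2 : MemLp (fun x => v x - m) (ENNReal.ofReal 2) (volume.restrict Ω) :=
    hv2.sub (memLp_const m)
  have hσn : normL 2 Ω (fun x => σ * (v x - m)) = normL 2 Ω (fun x => v x - m) := by
    rcases hσ2 with h | h
    · simp only [h, one_mul]
    · simp only [h, neg_one_mul, normL_neg 2 Ω (fun x => v x - m)]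
  have n2 : normL 2 Ω (fun x => σ * v x - c) ≤
      (C + C * c * V ^ ((1 : ℝ) / 2)) * gagliardo s Ω v := by
    have h := normL_add_le one_le_two (hw2.const_mul σ) (memLp_const (|m| - c))
    rw [hσn, normL_const two_pos] at h
    have e : (fun x => σ * (v x - m) + (|m| - c)) = fun x => σ * v x - c := by
      funext x; rw [← hσm]; ring
    rw [e] at h
    have := mul_le_mul_of_nonneg_right hmc (show 0 ≤ V ^ ((1 : ℝ) / 2) by positivity)
    linarith
  have ng : gagliardo s Ω (fun x => σ * v x - c) = gagliardo s Ω v := by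
    rw [gagliardo_sub_const s Ω (fun x => σ * v x) c]
    rcases hσ2 with h | h
    · simp only [h, one_mul]
    · simp only [h, neg_one_mul, gagliardo, neg_sub_neg]
      simp only [sub_sq_comm]
  have hn0 := normL_nonneg 2 Ω (fun x => σ * v x - c)
  calc normHs s Ω (fun x => σ * v x - c)
      ≤ gagliardo s Ω v + normL 2 Ω (fun x => σ * v x - c) := by
        rw [normHs, ng]
        exact Real.sqrt_le_iff.2 ⟨by positivity, by nlinarith⟩
    _ ≤ _ := by linarith

/-- The source of smallness: bounded energy forces the seminorm to be `O(ε^s)`. -/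
theorem gagliardo_le_rpow_mul_sqrt_scaledEnergy {n : ℕ} {s ε : ℝ} (hε : 0 < ε) (Ω : Set (Rn n))
    (v : Rn n → ℝ) : gagliardo s Ω v ≤ ε ^ s * √(scaledEnergy s ε Ω v) := by
  have e : ε ^ (2 * s) * ε ^ (-(2 * s)) = 1 := by
    rw [← Real.rpow_add hε, add_neg_cancel, Real.rpow_zero]
  have e' : (ε ^ s) ^ 2 = ε ^ (2 * s) := by
    rw [← Real.rpow_natCast, ← Real.rpow_mul hε.le]; congr 1; push_cast; ring
  have h0 : 0 ≤ scaledEnergy s ε Ω v := by unfold scaledEnergy; positivity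
  refine le_of_sq_le_sq ?_ (by positivity)
  rw [mul_pow, Real.sq_sqrt h0, e', scaledEnergy, mul_add, ← mul_assoc, e, one_mul]
  exact le_add_of_nonneg_right (by positivity)

theorem normL_two_le_sqrt_scaledEnergy {n : ℕ} {s ε : ℝ} (hε : 0 < ε) (Ω : Set (Rn n))
    (v : Rn n → ℝ) : normL 2 Ω v ≤ √(scaledEnergy s ε Ω v) :=
  Real.le_sqrt_of_sq_le (le_add_of_nonneg_left (by positivity))

theorem normL_pos {n : ℕ} {q : ℝ} (hq : 0 < q) {Ω : Set (Rn n)} {v : Rn n → ℝ}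
    (hvq : MemLp v (ENNReal.ofReal q) (volume.restrict Ω))
    (hv : ¬ (v =ᵐ[volume.restrict Ω] 0)) : 0 < normL q Ω v := by
  refine ENNReal.toReal_pos (fun h => hv ?_) hvq.2.ne
  exact (eLpNorm_eq_zero_iff hvq.1 (by simpa using hq)).1 h

/-- The two energy bounds turn `H` into `‖v‖_q ≤ (K + C ε^s) √E(v)`. Nonemptiness `hne` matters
because the real `sInf` of the empty set is `0`. -/
theorem le_sobolevConst_smul_set {n : ℕ} {s q ε : ℝ} (hε : 0 < ε) (hq : 0 < q) {Ω : Set (Rn n)}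
    {C K : ℝ} (hC : 0 < C)
    (hK : 0 < K) (H : ∀ v, MemHs s Ω v → MemLp v (ENNReal.ofReal q) (volume.restrict Ω) ∧
      normL q Ω v ≤ K * normL 2 Ω v + C * gagliardo s Ω v)
    (hne : ∃ u, MemHsNonzero s (ε • Ω) u) :
    ((K + C * ε ^ s) ^ 2)⁻¹ ≤ sobolevConst s q (ε • Ω) / ε ^ ((n : ℝ) * (1 - 2 / q)) := by
  rw [le_div_iff₀' (by positivity)]
  obtain ⟨u₀, hu₀⟩ := hne
  refine le_csInf ⟨_, u₀, hu₀, rfl⟩ ?_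
  rintro _ ⟨u, hu, rfl⟩
  rw [quotient_smul_set hε hq]
  refine mul_le_mul_of_nonneg_left ?_ (by positivity)
  set v := rescale ε u
  obtain ⟨hvq, hle⟩ := H v (hu.1.rescale hε)
  have hv0 : ¬ (v =ᵐ[volume.restrict Ω] 0) := fun h =>
    hu.2 ((ae_restrict_smul_set hε Ω (fun x => u x = 0)).2 h)
  have hpos := normL_pos hq hvq hv0
  have h1 := gagliardo_le_rpow_mul_sqrt_scaledEnergy (s := s) hε Ω v
  have h2 := normL_two_le_sqrt_scaledEnergy (s := s) hε Ω v
  have h0 : 0 ≤ scaledEnergy s ε Ω v := by unfold scaledEnergy; positivity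
  have h3 : normL q Ω v ≤ (K + C * ε ^ s) * √(scaledEnergy s ε Ω v) := by
    have a1 := mul_le_mul_of_nonneg_left h1 hC.le
    have a2 := mul_le_mul_of_nonneg_left h2 hK.le
    linarith
  have h4 : normL q Ω v ^ 2 ≤ (K + C * ε ^ s) ^ 2 * scaledEnergy s ε Ω v := by
    rw [← Real.sq_sqrt h0, ← mul_pow]
    gcongr
  rw [inv_le_iff_one_le_mul₀ (by positivity), div_mul_eq_mul_div, one_le_div (by positivity)]
  linarith

end FracSobolev

/-! ### The limit of the constants and of the extremals -/

theorem lemma3p2 (n : ℕ) (hn : 1 ≤ n) (s : ℝ) (hs0 : 0 < s) (hs1 : s < 1)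
    (q : ℝ) (hq1 : 1 ≤ q) (hq : ENNReal.ofReal q < FracSobolev.critExp n s) (hq2 : q ≠ 2)
    (Ω : Set (FracSobolev.Rn n)) (hΩ : FracSobolev.IsBoundedSmoothDomain Ω) :
    Tendsto (fun ε : ℝ => FracSobolev.sobolevConst s q (ε • Ω) / ε ^ ((n : ℝ) * (1 - 2 / q)))
      (𝓝[>] 0) (𝓝 ((volume Ω).toReal ^ (1 - 2 / q))) ∧
    ∀ u : ℝ → FracSobolev.Rn n → ℝ,
      (∀ᶠ ε in 𝓝[>] (0 : ℝ), FracSobolev.IsExtremal s q (ε • Ω) (u ε) ∧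
        FracSobolev.normL q Ω (FracSobolev.rescale ε (u ε)) = 1) →
      (∀ᶠ ε in 𝓝[>] (0 : ℝ), FracSobolev.MemHs s Ω (FracSobolev.rescale ε (u ε))) ∧
      (∃ σ : ℝ → ℝ, (∀ ε, σ ε = 1 ∨ σ ε = -1) ∧
        Tendsto (fun ε : ℝ => FracSobolev.normHs s Ω
            (fun x => σ ε * FracSobolev.rescale ε (u ε) x - (volume Ω).toReal ^ (-(1 / q))))
          (𝓝[>] 0) (𝓝 0)) ∧
      ((∀ᶠ ε in 𝓝[>] (0 : ℝ), ∀ᵐ x ∂(volume.restrict (ε • Ω)), 0 ≤ u ε x) →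
        Tendsto (fun ε : ℝ => FracSobolev.normHs s Ω
            (fun x => FracSobolev.rescale ε (u ε) x - (volume Ω).toReal ^ (-(1 / q))))
          (𝓝[>] 0) (𝓝 0)) := by
  open FracSobolev in
  have hq0 : 0 < q := by linarith
  have hlt : volume Ω < ⊤ := hΩ.isBounded.measure_lt_top
  have : IsFiniteMeasure (volume.restrict Ω) := ⟨by rwa [Measure.restrict_apply_univ]⟩
  have hvol : 0 < volume Ω := hΩ.isOpen.measure_pos volume hΩ.isConnected.nonempty
  have hV : 0 < (volume Ω).toReal := ENNReal.toReal_pos hvol.ne' hlt.ne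
  obtain ⟨C, hC, H⟩ := poincare_sobolev hn hs0 hΩ.isOpen.measurableSet hΩ.isBounded hV
    (hΩ.corkscrew.mono subset_closure) hq1 hq
  set V := (volume Ω).toReal with hVdef
  have hεs : Tendsto (fun ε : ℝ => ε ^ s) (𝓝[>] 0) (𝓝 0) := by
    have := (Real.continuousAt_rpow_const 0 s (Or.inr hs0.le)).tendsto
    rw [Real.zero_rpow hs0.ne'] at this
    exact this.mono_left nhdsWithin_le_nhds
  refine ⟨?_, fun u hu => ?_⟩
  · set K := V ^ (1 / q - 1 / 2)
    have hK : 0 < K := by positivity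
    set C' := C + K * C
    have hlim : Tendsto (fun ε : ℝ => ((K + C' * ε ^ s) ^ 2)⁻¹) (𝓝[>] 0)
        (𝓝 (V ^ (1 - 2 / q))) := by
      have h := ((tendsto_const_nhds (x := K)).add
        (hεs.const_mul C')).pow 2 |>.inv₀ (by rw [mul_zero, add_zero]; positivity)
      rw [mul_zero, add_zero] at h
      have e : (K ^ 2)⁻¹ = V ^ (1 - 2 / q) := by
        simp only [K]
        rw [← Real.rpow_natCast, ← Real.rpow_mul hV.le, ← Real.rpow_neg hV.le]
        congr 1
        push_cast
        ring
      rwa [e] at h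
    refine tendsto_of_tendsto_of_tendsto_of_le_of_le' hlim tendsto_const_nhds ?_ ?_
    · filter_upwards [self_mem_nhdsWithin] with ε hε
      have hε0 : 0 < ε := hε
      have hlt' : volume (ε • Ω) < ⊤ := (hΩ.isBounded.smul₀ ε).measure_lt_top
      have : IsFiniteMeasure ((volume : Measure (Rn n)).restrict (ε • Ω)) :=
        ⟨by rwa [Measure.restrict_apply_univ]⟩
      have hne : volume (ε • Ω) ≠ 0 := by
        rw [Measure.addHaar_smul]
        exact mul_ne_zero (by simp [hε0.ne']) hvol.ne'
      refine le_sobolevConst_smul_set hε0 hq0 (by positivity) hK (fun v hv => ?_)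
        ⟨_, memHsNonzero_one s hne⟩
      obtain ⟨h1, h2, h3⟩ := H v hv
      exact ⟨h1, normL_le_normL_two_add hV hq1 hv h1 h2 h3⟩
    · filter_upwards [self_mem_nhdsWithin] with ε hε
      exact sobolevConst_smul_set_le hε hq0 hV
  · have hmem : ∀ᶠ ε in 𝓝[>] (0 : ℝ), MemHs s Ω (rescale ε (u ε)) := by
      filter_upwards [self_mem_nhdsWithin, hu] with ε hε h
      exact h.1.1.1.rescale hε
    -- For a normalised extremal the scaled energy equals `S(ε Ω) / ε^(n(1-2/q))`, which the
    -- constant test function bounds.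
    have hgle : ∀ᶠ ε in 𝓝[>] (0 : ℝ),
        gagliardo s Ω (rescale ε (u ε)) ≤ ε ^ s * √(V ^ (1 - 2 / q)) := by
      filter_upwards [self_mem_nhdsWithin, hu] with ε hε h
      have hε0 : 0 < ε := hε
      have hE := sobolevConst_smul_set_le (s := s) hε0 hq0 hV
      rw [← h.1.2, quotient_smul_set hε0 hq0, h.2, one_pow, div_one,
        mul_div_cancel_left₀ _ (by positivity)] at hE
      exact (gagliardo_le_rpow_mul_sqrt_scaledEnergy hε0 Ω _).trans (by gcongr)
    have hconv : Tendsto (fun ε : ℝ => normHs s Ω (fun x =>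
        meanSign Ω (rescale ε (u ε)) * rescale ε (u ε) x - V ^ (-(1 / q)))) (𝓝[>] 0) (𝓝 0) := by
      set B := 1 + (C + C * V ^ (-(1 / q)) * V ^ ((1 : ℝ) / 2))
      have hlim : Tendsto (fun ε : ℝ => B * (ε ^ s * √(V ^ (1 - 2 / q)))) (𝓝[>] 0) (𝓝 0) := by
        simpa using (hεs.mul_const (√(V ^ (1 - 2 / q)))).const_mul B
      refine squeeze_zero' (Eventually.of_forall fun _ => normHs_nonneg _ _ _) ?_ hlim
      filter_upwards [hmem, hgle, hu] with ε h1 h2 h3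
      obtain ⟨a1, a2, a3⟩ := H _ h1
      exact (normHs_meanSign_mul_sub_le hV hq1 h1 a1 a2 a3 h3.2).trans
        (mul_le_mul_of_nonneg_left h2 (by positivity))
    refine ⟨hmem, ⟨_, fun ε => meanSign_eq_or Ω _, hconv⟩, fun hpos => ?_⟩
    -- A nonnegative function has nonnegative mean, so its sign is already `1`.
    refine hconv.congr' ?_
    filter_upwards [self_mem_nhdsWithin, hpos] with ε hε h
    have hm : 0 ≤ mean Ω (rescale ε (u ε)) :=
      div_nonneg (integral_nonneg_of_ae ((ae_restrict_smul_set hε Ω _).1 h)) hV.le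
    simp only [meanSign, if_pos hm, one_mul]
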